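/- **Setting.** Let $\Phi$ be a physical theory on Euclidean momentum space $V=\mathbb R^4$, given by its particle species, its elementary interaction vertices, its matrix-valued momentum-space propagators $\Delta_p(q)$ and its power-counting weights. A *primitive diagram* of $\Phi$ is an isomorphism class of one-particle-irreducible, superficially divergent Feynman diagrams of $\Phi$ (with at least one internal edge) having no superficially divergent proper 1PI subdiagram. For $s>0$ let $\gamma^{(s)}$ denote the primitive diagram $\gamma$ with all internal momenta at scale $s$, i.e. with propagators $q\mapsto\Delta_p(sq)$ on its internal edges. Let $\mathbb K$ be $\mathbb R$ or $\mathbb C$, let $H$ be the free commutative $\mathbb K$-algebra on non-planar rooted trees whose vertices are decorated by such $\gamma^{(s)}$ (the Connes–Kreimer algebra of $\Phi$), and let $B^+_{d}:H\to H$ be the linear grafting operator joining the roots of a forest to a new root decorated by $d$. For $\Lambda>0$ let $\theta_\Lambda:H\to H$ be the algebra endomorphism multiplying all internal momenta by $\Lambda$ (it replaces each decoration $\gamma^{(s)}$ by $\gamma^{(\Lambda s)}$). Let $g$ be a formal variable (the bare coupling constant). $\mathcal S^{\Phi,g}$ is the set of all Dyson–Schwinger equations $$X=1+\sum_{n\ge1}(\ell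 g)^n\,\omega_n\,B^+_{\gamma_n^{(s)}}(X^{n+1}),\qquad X\in H[[g]],$$ with $0<\ell\le1$, $s>0$, $\omega_n\in\mathbb K$ and primitive diagrams $\gamma_n$; data for which all the operators $\ell^n\omega_nB^+_{\gamma_n^{(s)}}$ agree define the same element. Let $M_{\rm bare}=M_{\rm running}=(0,\infty)$. The *fixed point equation of ${\rm DSE}$ at the scales* $(\tau,\Lambda)\in M_{\rm bare}\times M_{\rm running}$ is $$X=1+\sum_{n\ge1}(\tau \ell g)^n\,\omega_n\,B^+_{\gamma_n^{(\Lambda s)}}(X^{n+1});$$ that is, $g$ is replaced by $\tau g$ and all internal momenta are multiplied by $\Lambda$. An equation ${\rm DSE}'\in\mathcal S^{\Phi,g}$ is *effective at the scales $m'$* of the original equation ${\rm DSE}$ at the scales $m$ if the right-hand side of the fixed point equation of ${\rm DSE}$ at $m$ and that of ${\rm DSE}'$ at $m'$ coincide as maps $H[[g]]\to H[[g]]$. **Theorem.** There are scale maps $R^{\rm bare}_{\tau\tau'}$, $R^{\rm running}_{\Lambda\Lambda'}$ and $R^{\rm multi}_{(\tau,\Lambda)(\tau',\Lambda')}$ from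 $\mathcal S^{\Phi,g}$ to itself, defined for all scales, such that: 1. (Effective equations.) For all ${\rm DSE}$ and all scales, $R^{\rm multi}_{m m'}{\rm DSE}$ is the unique equation in $\mathcal S^{\Phi,g}$ that is effective at $m'$ of ${\rm DSE}$ at $m$. For every $\Lambda$, $R^{\rm bare}_{\tau\tau'}{\rm DSE}$ is the unique equation effective at $(\tau',\Lambda)$ of ${\rm DSE}$ at $(\tau,\Lambda)$. For every $\tau$, $R^{\rm running}_{\Lambda\Lambda'}{\rm DSE}$ is the unique equation effective at $(\tau,\Lambda')$ of ${\rm DSE}$ at $(\tau,\Lambda)$. In particular $R^{\rm multi}_{(\tau,\Lambda)(\tau',\Lambda)}=R^{\rm bare}_{\tau\tau'}$ and $R^{\rm multi}_{(\tau,\Lambda)(\tau,\Lambda')}=R^{\rm running}_{\Lambda\Lambda'}$. 2. (Composition.) For each of the three families and all scales $a,b,c$, $R_{ab}\circ R_{bc}=R_{ac}$ and $R_{bc}\circ R_{ab}=R_{ac}$. 3. (Semigroup actions.) For each of the three families, with $M=M_{\rm bare}$, $M_{\rm running}$, $M_{\rm bare}\times M_{\rm running}$ respectively, the multiplicative semigroup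 $(0,1]$ acts on $\mathcal S^{\Phi,g}\times M$ by $$r\circ({\rm DSE},a)=(R_{a,\,ra}{\rm DSE},\,ra),$$ and likewise by $r\circ({\rm DSE},a)=(R_{ra,\,a}{\rm DSE},\,ra)$; here $r(\tau,\Lambda)=(r\tau,r\Lambda)$ in the joint case. 4. (Solutions.) For every ${\rm DSE}$ there are $X_0=1,X_1,X_2,\dots\in H$ such that for all $(\tau,\Lambda)$ the fixed point equation of ${\rm DSE}$ at $(\tau,\Lambda)$ has exactly one solution in $H[[g]]$, namely $\sum_{n\ge0}(\tau g)^n\,\theta_\Lambda(X_n)$. -/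

import Mathlib

noncomputable section

namespace MultiScaleRG

/-! Physical theories and their Feynman diagrams. -/

/-- Vectors of the Euclidean four-dimensional momentum space. -/
abbrev Momentum : Type := EuclideanSpace ℝ (Fin 4)

/-- A (regularization independent) specification of the Feynman rules of a physical theory:
particle species, elementary interactions, propagators in momentum space (matrices in the internal,
Lorentz and spinor indices) and power counting weights. -/
structure PhysicalTheory where
  Particle : Type
  finite_particle : Finite Particle
  /-- charge conjugation -/
  conj : Particle → Particle
  conj_conj : ∀ p, conj (conj p) = p
  /-- `1` for bosons, `-1` for fermions -/
  statistics : Particle → ℤˣ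
  /-- the allowed interaction vertices, each given by the species of its legs -/
  interactions : Set (Multiset Particle)
  Component : Type
  finite_component : Finite Component
  propagator : Particle → Momentum → Matrix Component Component ℂ
  propagator_conj : ∀ p q,
    propagator (conj p) (-q) = ((statistics p : ℤ) : ℂ) • (propagator p q).transpose
  /-- the propagator of `p` falls off as `|q| ^ (-propagatorDegree p)` -/
  propagatorDegree : Particle → ℤ
  propagatorDegree_conj : ∀ p, propagatorDegree (conj p) = propagatorDegree p
  propagator_decay : ∀ p i j, Asymptotics.IsBigO (Bornology.cobounded Momentum)
    (fun q => propagator p q i j) (fun q => ‖q‖ ^ (-propagatorDegree p))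
  /-- the number of powers of momentum carried by an interaction vertex -/
  vertexDegree : Multiset Particle → ℤ

/-- A Feynman diagram of `Φ`: half-edges are attached to vertices, and an involution glues them;
its two-element orbits are the internal edges and its fixed points the external legs. -/
structure FeynmanDiagram (Φ : PhysicalTheory) where
  numVertices : ℕ
  numHalfEdges : ℕ
  vertexOf : Fin numHalfEdges → Fin numVertices
  species : Fin numHalfEdges → Φ.Particle
  glue : Fin numHalfEdges → Fin numHalfEdges
  glue_glue : ∀ h, glue (glue h) = h
  species_glue : ∀ h, glue h ≠ h → species (glue h) = Φ.conj (species h)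
  vertex_mem : ∀ v,
    (Finset.univ.filter fun h => vertexOf h = v).val.map species ∈ Φ.interactions

namespace FeynmanDiagram

variable {Φ : PhysicalTheory} (Γ : FeynmanDiagram Φ)

/-- The half-edges that belong to internal edges. -/
def internal : Finset (Fin Γ.numHalfEdges) :=
  Finset.univ.filter fun h => Γ.glue h ≠ h

/-- A set of internal edges, given as the set of their half-edges. It stands for the subgraph formed
by these edges and their end points (all other half-edges there become external legs). -/
def IsEdgeSet (E : Finset (Fin Γ.numHalfEdges)) : Prop :=
  E ⊆ Γ.internal ∧ ∀ h ∈ E, Γ.glue h ∈ E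

/-- The end points of the edges in `E`. -/
def endPoints (E : Finset (Fin Γ.numHalfEdges)) : Finset (Fin Γ.numVertices) :=
  E.image Γ.vertexOf

/-- Any two vertices in `W` are joined by a path of edges in `E`. -/
def ConnectedOn (E : Finset (Fin Γ.numHalfEdges)) (W : Finset (Fin Γ.numVertices)) : Prop :=
  ∀ v ∈ W, ∀ w ∈ W, Relation.ReflTransGen
    (fun a b => ∃ h ∈ E, Γ.vertexOf h = a ∧ Γ.vertexOf (Γ.glue h) = b) v w

/-- One particle irreducible: connected, also after the removal of any one internal edge. -/
def OnePI (E : Finset (Fin Γ.numHalfEdges)) : Prop :=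
  E.Nonempty ∧ Γ.ConnectedOn E (Γ.endPoints E) ∧
    ∀ h ∈ E, Γ.ConnectedOn ((E.erase h).erase (Γ.glue h)) (Γ.endPoints E)

/-- Twice the superficial degree of divergence `4 L - ∑ₑ propagatorDegree e + ∑ᵥ vertexDegree v` of a
connected subgraph; as `E` lists half-edges, twice its loop number `L` is `|E| - 2 |V| + 2`. -/
def twiceDivergenceDegree (E : Finset (Fin Γ.numHalfEdges)) : ℤ :=
  4 * ((E.card : ℤ) - 2 * ((Γ.endPoints E).card : ℤ) + 2)
    - ∑ h ∈ E, Φ.propagatorDegree (Γ.species h)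
    + 2 * ∑ v ∈ Γ.endPoints E,
        Φ.vertexDegree ((Finset.univ.filter fun h => Γ.vertexOf h = v).val.map Γ.species)

/-- Primitive diagrams: 1PI superficially divergent diagrams without divergent proper 1PI
subgraphs. -/
def IsPrimitive : Prop :=
  Γ.endPoints Γ.internal = Finset.univ ∧ Γ.OnePI Γ.internal ∧
    0 ≤ Γ.twiceDivergenceDegree Γ.internal ∧
    ∀ E, Γ.IsEdgeSet E → E ≠ Γ.internal → Γ.OnePI E → Γ.twiceDivergenceDegree E < 0

/-- Isomorphism of Feynman diagrams. -/
def Iso (Γ Γ' : FeynmanDiagram Φ) : Prop :=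
  ∃ (a : Fin Γ.numVertices ≃ Fin Γ'.numVertices) (b : Fin Γ.numHalfEdges ≃ Fin Γ'.numHalfEdges),
    (∀ h, Γ'.vertexOf (b h) = a (Γ.vertexOf h)) ∧
    (∀ h, Γ'.glue (b h) = b (Γ.glue h)) ∧
    ∀ h, Γ'.species (b h) = Γ.species h

end FeynmanDiagram

/-- Isomorphism classes of primitive Feynman diagrams of `Φ`. -/
def PrimitiveDiagram (Φ : PhysicalTheory) : Type :=
  Quot fun Γ Γ' : {Γ : FeynmanDiagram Φ // Γ.IsPrimitive} => FeynmanDiagram.Iso Γ.1 Γ'.1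

/-- Scales: positive real numbers. -/
abbrev Scale : Type := {x : ℝ // 0 < x}

/-- A primitive Feynman diagram together with the propagators on its internal edges, whose momenta
are measured in some scale `s`: the propagator of `p` is `q ↦ Φ.propagator p (s q)`. -/
@[ext]
structure ScaledDiagram (Φ : PhysicalTheory) where
  diagram : PrimitiveDiagram Φ
  propagator : Φ.Particle → Momentum → Matrix Φ.Component Φ.Component ℂ
  exists_scale : ∃ s : Scale, propagator = fun p q => Φ.propagator p ((s : ℝ) • q)

namespace ScaledDiagram

variable {Φ : PhysicalTheory}

/-- The diagram `γ` with internal momenta at the scale `s`. -/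
def atScale (γ : PrimitiveDiagram Φ) (s : Scale) : ScaledDiagram Φ :=
  ⟨γ, fun p q => Φ.propagator p ((s : ℝ) • q), s, rfl⟩

/-- Multiply the momenta of all internal edges by `Λ`. -/
def rescale (Λ : Scale) (d : ScaledDiagram Φ) : ScaledDiagram Φ where
  diagram := d.diagram
  propagator := fun p q => d.propagator p ((Λ : ℝ) • q)
  exists_scale := by
    obtain ⟨s, hs⟩ := d.exists_scale
    refine ⟨s * Λ, ?_⟩
    funext p q
    rw [hs, Positive.val_mul, mul_smul]

end ScaledDiagram

/-! The algebra of decorated non-planar rooted trees and the grafting operators. -/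

/-- Planar rooted trees with vertices decorated by `D`. -/
inductive PlanarTree (D : Type) : Type
  | node : D → List (PlanarTree D) → PlanarTree D

namespace PlanarTree

variable {D D' : Type}

/-- One reordering of the branches at one vertex. -/
inductive Reorder : PlanarTree D → PlanarTree D → Prop
  | perm (d : D) {l l' : List (PlanarTree D)} : l.Perm l' → Reorder (node d l) (node d l')
  | branch (d : D) (l₁ l₂ : List (PlanarTree D)) {t t' : PlanarTree D} :
      Reorder t t' → Reorder (node d (l₁ ++ t :: l₂)) (node d (l₁ ++ t' :: l₂))

/-- Change the decorations. -/
def map (f : D → D') : PlanarTree D → PlanarTree D'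
  | node d l => node (f d) (l.map (map f))

theorem Reorder.map (f : D → D') {t t' : PlanarTree D} (h : Reorder t t') :
    Reorder (t.map f) (t'.map f) := by
  induction h with
  | perm d h =>
    simp only [PlanarTree.map]
    exact Reorder.perm _ (h.map _)
  | branch d l₁ l₂ _ ih =>
    simp only [PlanarTree.map, List.map_append, List.map_cons]
    exact Reorder.branch _ _ _ ih

end PlanarTree

/-- Isomorphism classes of non-planar rooted trees with vertices decorated by `D`. -/
def RootedTree (D : Type) : Type := Quot (PlanarTree.Reorder (D := D))

namespace RootedTree

variable {D D' : Type}

/-- The tree with root decorated by `d` and the trees of the forest `F` as its branches. -/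
def graft (d : D) (F : Multiset (RootedTree D)) : RootedTree D :=
  Quot.mk _ (PlanarTree.node d (F.toList.map Quot.out))

/-- Change the decorations. -/
def map (f : D → D') : RootedTree D → RootedTree D' :=
  Quot.map (PlanarTree.map f) fun _ _ h => h.map f

end RootedTree

/-- The Connes--Kreimer algebra of decorated rooted trees: the free commutative algebra on rooted
trees, whose monomials are the forests; its unit is the empty forest. -/
abbrev TreeAlgebra (𝕜 : Type) [RCLike 𝕜] (D : Type) : Type := MvPolynomial (RootedTree D) 𝕜

section Equations

variable {𝕜 : Type} [RCLike 𝕜]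

/-- The grafting operator `B⁺_d`: it sends each forest to the tree obtained by joining the roots of
the forest to a new root decorated by `d`. -/
def grafting {D : Type} (d : D) : TreeAlgebra 𝕜 D →ₗ[𝕜] TreeAlgebra 𝕜 D :=
  (MvPolynomial.basisMonomials (RootedTree D) 𝕜).constr 𝕜 fun F =>
    MvPolynomial.X (RootedTree.graft d (Finsupp.toMultiset F))

/-- The linear combination `∑_d c(d) B⁺_d` of grafting operators. -/
def graftingSum {D : Type} (c : D →₀ 𝕜) : TreeAlgebra 𝕜 D →ₗ[𝕜] TreeAlgebra 𝕜 D :=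
  c.sum fun d a => a • grafting d

variable (𝕜) in
/-- Trees and forests of scaled primitive diagrams of `Φ`. -/
abbrev DiagramAlgebra (Φ : PhysicalTheory) : Type := TreeAlgebra 𝕜 (ScaledDiagram Φ)

/-- Multiply all internal momenta in all diagrams by `Λ`. -/
def momentumRescale {Φ : PhysicalTheory} (Λ : Scale) :
    DiagramAlgebra 𝕜 Φ →ₐ[𝕜] DiagramAlgebra 𝕜 Φ :=
  MvPolynomial.rename (RootedTree.map (ScaledDiagram.rescale Λ))

variable (𝕜) in
/-- The space of all Dyson--Schwinger equations
`X = 1 + ∑_{n ≥ 1} (ℓ g)ⁿ ωₙ B⁺_{γₙ}(X ^ (n + 1))` of `Φ` under the couplings `ℓ g`, `0 < ℓ ≤ 1`, where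
the `γₙ` are primitive diagrams at a common momentum scale `s`. Such an equation is recorded by its
cocycles, `c n` standing for `ℓⁿ ωₙ B⁺_{γₙ}`, so that data giving the same equation are identified;
there is no cocycle of order zero. -/
def DysonSchwingerSpace (Φ : PhysicalTheory) : Set (ℕ → (ScaledDiagram Φ →₀ 𝕜)) :=
  {c | c 0 = 0 ∧ ∃ (ℓ : ℝ) (s : Scale) (γ : ℕ → PrimitiveDiagram Φ) (ω : ℕ → 𝕜),
    0 < ℓ ∧ ℓ ≤ 1 ∧
      ∀ n, 1 ≤ n → c n = Finsupp.single (ScaledDiagram.atScale (γ n) s) ((ℓ : 𝕜) ^ n * ω n)}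

/-- The right hand side `1 + ∑_{n ≥ 1} (τ g)ⁿ B⁺_{cₙ}(X ^ (n + 1))` of the fixed point equation of the
Green's function belonging to `c` at the scale `m = (τ, Λ)`: the bare coupling `g` is replaced by
`τ g` and the internal momenta are multiplied by `Λ`. Power series are in the formal variable `g`. -/
def fixedPointMap {Φ : PhysicalTheory} (c : ℕ → (ScaledDiagram Φ →₀ 𝕜)) (m : Scale × Scale)
    (X : PowerSeries (DiagramAlgebra 𝕜 Φ)) : PowerSeries (DiagramAlgebra 𝕜 Φ) :=
  1 + PowerSeries.mk fun k => ∑ n ∈ Finset.Icc 1 k,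
    (((m.1 : ℝ) : 𝕜) ^ n) •
      graftingSum ((c n).mapDomain (ScaledDiagram.rescale m.2))
        (PowerSeries.coeff (k - n) (X ^ (n + 1)))

/-- `D'` is effective at the scale `m'` of the original equation `D` at the scale `m`: the fixed point
equations of the Green's functions of `D` at `m` and of `D'` at `m'` coincide. -/
def IsEffective {Φ : PhysicalTheory} (m m' : Scale × Scale)
    (D D' : DysonSchwingerSpace 𝕜 Φ) : Prop :=
  fixedPointMap D.1 m = fixedPointMap D'.1 m'

end Equations

/-! Renormalization groups. -/

/-- The semigroup `(0, 1]` of scaling factors. -/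
abbrev ScaleFactor : Type := Set.Ioc (0 : ℝ) 1

/-- The scale `r a`. -/
def ScaleFactor.mul (r : ScaleFactor) (a : Scale) : Scale := ⟨(r : ℝ) * a, mul_pos r.2.1 a.2⟩

/-- The pair of scales `(r τ, r Λ)`. -/
def ScaleFactor.mulPair (r : ScaleFactor) (m : Scale × Scale) : Scale × Scale :=
  (r.mul m.1, r.mul m.2)

/-- The scale maps `R a b` form a renormalization group on the space `S` of equations with scales in
`M`: `R a b D` is the unique equation which is effective at the scale `b` of `D` at the scale `a`,
the scale maps are composable, and they give actions of the semigroup `(0, 1]` on `S × M`. -/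
structure IsRenormalizationGroup {S M : Type} (scale : ScaleFactor → M → M)
    (Effective : M → M → S → S → Prop) (R : M → M → S → S) : Prop where
  effective_iff : ∀ a b D D', Effective a b D D' ↔ D' = R a b D
  comp : ∀ a b c D, R a b (R b c D) = R a c D
  comp' : ∀ a b c D, R b c (R a b D) = R a c D
  /-- `r ∘ (D, a) = (R_{a, r a} D, r a)` -/
  action : ∃ act : MulAction ScaleFactor (S × M),
    ∀ r D a, act.smul r (D, a) = (R a (scale r a) D, scale r a)
  /-- `r ∘ (D, a) = (R_{r a, a} D, r a)` -/
  action' : ∃ act : MulAction ScaleFactor (S × M),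
    ∀ r D a, act.smul r (D, a) = (R (scale r a) a D, scale r a)

end MultiScaleRG

end

open MultiScaleRG

namespace MultiScaleRG

/-! ### Momentum rescaling of decorations -/

namespace ScaledDiagram

variable {Φ : PhysicalTheory}

/-! The group of pairs of scales acts on equations: `DysonSchwingerSpace.scale a b` multiplies the
cocycle of order n by aⁿ and rescales its momenta by b. The fixed point map at m sees only the
equation scaled by m. Conversely it determines that equation: at X = 1 the coefficient of gᵏ is a
combination of one-vertex trees, which are independent for distinct decorations
(`graftingSum_one_injective`). So E' is effective iff scaling E by m and E' by m' agree, that is,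
iff E' is E scaled by m'⁻¹m (`isEffective_iff`). The composition and action laws are then identities
in a commutative group.

For solutions, every cocycle carries a positive power of g, so the fixed point map is an X-adic
contraction. The substitution g ↦ τg together with θ_Λ is a ring homomorphism that intertwines the
maps at (1, 1) and (τ, Λ), because relabelling commutes with grafting; it carries the solution at
(1, 1) to the one at (τ, Λ). -/

theorem rescale_rescale (a b : Scale) (d : ScaledDiagram Φ) :
    rescale a (rescale b d) = rescale (a * b) d := by
  ext1
  · rfl
  · funext p q
    simp only [rescale, Positive.val_mul, smul_smul, mul_comm]

theorem rescale_one (d : ScaledDiagram Φ) : rescale 1 d = d := by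
  ext1
  · rfl
  · funext p q
    simp [rescale]

theorem rescale_atScale (a s : Scale) (γ : PrimitiveDiagram Φ) :
    rescale a (atScale γ s) = atScale γ (s * a) := by
  ext1
  · rfl
  · funext p q
    simp only [rescale, atScale, Positive.val_mul, smul_smul]

end ScaledDiagram

/-! ### Rooted trees: grafting and relabelling -/

/-- The decoration of the root of a planar tree. -/
def PlanarTree.root {D : Type} : PlanarTree D → D
  | node d _ => d

namespace RootedTree

variable {D D' : Type}

/-- The decoration of the root. -/
def root : RootedTree D → D :=
  Quot.lift PlanarTree.root fun _ _ h => by cases h <;> rfl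

/-- The isomorphism class of a planar tree. -/
def ofPlanar (t : PlanarTree D) : RootedTree D := Quot.mk _ t

/-- A representative of a rooted tree. -/
noncomputable def toPlanar (t : RootedTree D) : PlanarTree D := Quot.out t

theorem ofPlanar_toPlanar (t : RootedTree D) : ofPlanar (toPlanar t) = t := Quot.out_eq t

theorem map_ofPlanar (f : D → D') (t : PlanarTree D) : map f (ofPlanar t) = ofPlanar (t.map f) :=
  rfl

/-- Branches are replaced one at a time; the prefix `l₀` collects those already treated. A single
replacement is legitimate because the class of the whole tree, as a function of one branch, descends
to the quotient. -/
theorem ofPlanar_node_append_congr (d : D) {l l' : List (PlanarTree D)}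
    (h : List.Forall₂ (fun t t' => ofPlanar t = ofPlanar t') l l') (l₀ : List (PlanarTree D)) :
    ofPlanar (PlanarTree.node d (l₀ ++ l)) = ofPlanar (PlanarTree.node d (l₀ ++ l')) := by
  induction h generalizing l₀ with
  | nil => rfl
  | @cons t t' l l' ht _ ih =>
    have h₁ : ofPlanar (PlanarTree.node d (l₀ ++ t :: l)) =
        ofPlanar (PlanarTree.node d (l₀ ++ t' :: l)) :=
      congrArg (Quot.lift (fun u => ofPlanar (PlanarTree.node d (l₀ ++ u :: l)))
        fun _ _ hu => Quot.sound (PlanarTree.Reorder.branch d l₀ l hu)) ht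
    rw [h₁]
    simpa using ih (l₀ ++ [t'])

/-- A planar tree represents the grafting of the forest of the classes of its branches. -/
theorem ofPlanar_node (d : D) (l : List (PlanarTree D)) :
    ofPlanar (PlanarTree.node d l) = graft d (l.map ofPlanar : List (RootedTree D)) := by
  -- `graft` makes two choices, an order of the forest and a representative of each tree: `hperm`
  -- undoes the first, `h₁` the second.
  have hperm : ((l.map ofPlanar : List (RootedTree D)) : Multiset (RootedTree D)).toList.Perm
      (l.map ofPlanar) :=
    Multiset.coe_eq_coe.1 (Multiset.coe_toList _)
  have h₁ : ofPlanar (PlanarTree.node d l) =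
      ofPlanar (PlanarTree.node d ((l.map ofPlanar).map toPlanar)) := by
    refine ofPlanar_node_append_congr d ?_ []
    rw [List.map_map, List.forall₂_map_right_iff, List.forall₂_same]
    exact fun t _ => (ofPlanar_toPlanar (ofPlanar t)).symm
  exact h₁.trans (Quot.sound (PlanarTree.Reorder.perm d (hperm.map toPlanar))).symm

theorem map_graft (f : D → D') (d : D) (F : Multiset (RootedTree D)) :
    map f (graft d F) = graft (f d) (F.map (map f)) := by
  have h : map f (graft d F) = ofPlanar (PlanarTree.node (f d)
      ((F.toList.map toPlanar).map (PlanarTree.map f))) := by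
    rw [← PlanarTree.map]
    rfl
  rw [h, ofPlanar_node]
  congr 1
  conv_rhs => rw [← Multiset.coe_toList F, Multiset.map_coe]
  rw [List.map_map, List.map_map]
  congr 1
  refine List.map_congr_left fun t _ => ?_
  rw [Function.comp_apply, Function.comp_apply, ← map_ofPlanar, ofPlanar_toPlanar]

end RootedTree

/-! ### Grafting operators -/

section Grafting

variable {𝕜 : Type} [RCLike 𝕜] {D D' : Type}

theorem grafting_monomial (d : D) (F : RootedTree D →₀ ℕ) :
    grafting (𝕜 := 𝕜) d (MvPolynomial.monomial F 1) =
      MvPolynomial.X (RootedTree.graft d (Finsupp.toMultiset F)) := by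
  have h := (MvPolynomial.basisMonomials (RootedTree D) 𝕜).constr_basis 𝕜 (fun F =>
    (MvPolynomial.X (RootedTree.graft d (Finsupp.toMultiset F)) : TreeAlgebra 𝕜 D)) F
  rwa [MvPolynomial.coe_basisMonomials] at h

/-- Both sides are linear in `p`, so it is enough to compare them on forests, where this is
`map_graft`. -/
theorem rename_grafting (f : D → D') (d : D) (p : TreeAlgebra 𝕜 D) :
    MvPolynomial.rename (RootedTree.map f) (grafting d p) =
      grafting (f d) (MvPolynomial.rename (RootedTree.map f) p) := by
  have h : (MvPolynomial.rename (RootedTree.map f)).toLinearMap ∘ₗ grafting (𝕜 := 𝕜) d =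
      grafting (f d) ∘ₗ (MvPolynomial.rename (RootedTree.map f)).toLinearMap := by
    refine (MvPolynomial.basisMonomials (RootedTree D) 𝕜).ext fun F => ?_
    simp only [MvPolynomial.coe_basisMonomials, LinearMap.comp_apply, AlgHom.toLinearMap_apply,
      MvPolynomial.rename_monomial, grafting_monomial, MvPolynomial.rename_X,
      RootedTree.map_graft, Finsupp.toMultiset_map]
  exact LinearMap.congr_fun h p

theorem graftingSum_apply (c : D →₀ 𝕜) (p : TreeAlgebra 𝕜 D) :
    graftingSum c p = c.sum fun d a => a • grafting d p := by
  simp [graftingSum, Finsupp.sum, LinearMap.sum_apply]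

theorem graftingSum_smul (a : 𝕜) (c : D →₀ 𝕜) : graftingSum (a • c) = a • graftingSum c := by
  simp only [graftingSum]
  rw [Finsupp.sum_smul_index (fun _ => by exact zero_smul _ _), Finsupp.smul_sum]
  simp only [mul_smul]

theorem rename_graftingSum (f : D → D') (c : D →₀ 𝕜) (p : TreeAlgebra 𝕜 D) :
    MvPolynomial.rename (RootedTree.map f) (graftingSum c p) =
      graftingSum (c.mapDomain f) (MvPolynomial.rename (RootedTree.map f) p) := by
  rw [graftingSum_apply, graftingSum_apply, Finsupp.sum_mapDomain_index (fun _ => by exact zero_smul _ _)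
    (fun _ _ _ => by exact add_smul _ _ _), map_finsuppSum]
  simp only [map_smul, rename_grafting]

/-- A linear combination of grafting operators is determined by its value at the empty forest. -/
theorem graftingSum_one_injective :
    Function.Injective fun c : D →₀ 𝕜 => graftingSum c (1 : TreeAlgebra 𝕜 D) := by
  have hg : ∀ d : D, grafting d (1 : TreeAlgebra 𝕜 D) =
      MvPolynomial.X (RootedTree.graft d 0) := fun d => by
    simpa using grafting_monomial (𝕜 := 𝕜) d 0
  have hcoeff : ∀ (c : D →₀ 𝕜) (d : D),
      MvPolynomial.coeff (Finsupp.single (RootedTree.graft d 0) 1)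
        (graftingSum c (1 : TreeAlgebra 𝕜 D)) = c d := by
    classical
    intro c d
    -- The root decoration is an isomorphism invariant, so it separates one-vertex trees.
    have hinj : ∀ e : D, RootedTree.graft e 0 = RootedTree.graft d 0 ↔ e = d := fun e =>
      ⟨fun h => congrArg RootedTree.root h, fun h => h ▸ rfl⟩
    rw [graftingSum_apply, Finsupp.sum, MvPolynomial.coeff_sum]
    simp only [hg, MvPolynomial.coeff_smul, MvPolynomial.coeff_X, smul_eq_mul, mul_ite, mul_one,
      mul_zero, Finsupp.single_left_inj one_ne_zero, hinj]
    simp [eq_comm]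
  intro c c' h
  ext d
  rw [← hcoeff c, ← hcoeff c']
  exact congrArg _ h

end Grafting

/-! ### Fixed points of contractions of power series -/

/-- A self-map of power series whose coefficients up to order `k` only depend on the coefficients
of order less than `k` of its argument has exactly one fixed point. -/
theorem _root_.PowerSeries.existsUnique_fixedPoint {R : Type*} [CommRing R]
    (F : PowerSeries R → PowerSeries R)
    (hF : ∀ k A B, (PowerSeries.X : PowerSeries R) ^ k ∣ A - B → PowerSeries.X ^ (k + 1) ∣ F A - F B) :
    ∃! A, A = F A := by
  have ext_of_dvd : ∀ A B : PowerSeries R, (∀ k, PowerSeries.X ^ k ∣ A - B) → A = B := by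
    intro A B h
    ext n
    have := PowerSeries.X_pow_dvd_iff.1 (h (n + 1)) n n.lt_succ_self
    rwa [map_sub, sub_eq_zero] at this
  have hstep : ∀ k, (PowerSeries.X : PowerSeries R) ^ k ∣ F^[k + 1] 0 - F^[k] 0 := by
    intro k
    induction k with
    | zero => simp
    | succ k ih =>
      rw [Function.iterate_succ_apply' F (k + 1), Function.iterate_succ_apply' F k]
      rw [Function.iterate_succ_apply' F k] at ih
      exact hF _ _ _ ih
  have hle : ∀ j k, j ≤ k → (PowerSeries.X : PowerSeries R) ^ j ∣ F^[k] 0 - F^[j] 0 := by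
    intro j k hjk
    induction k, hjk using Nat.le_induction with
    | base => simp
    | succ k hk ih =>
      have := dvd_add ((pow_dvd_pow PowerSeries.X hk).trans (hstep k)) ih
      simpa using this
  -- The iterate `F^[k]` at 0 is final only below order k, hence the shift to k + 1.
  set L : PowerSeries R := PowerSeries.mk fun k => PowerSeries.coeff k (F^[k + 1] 0)
  have hL : ∀ k, (PowerSeries.X : PowerSeries R) ^ k ∣ L - F^[k] 0 := by
    intro k
    refine PowerSeries.X_pow_dvd_iff.2 fun j hj => ?_
    have := PowerSeries.X_pow_dvd_iff.1 (hle (j + 1) k hj) j j.lt_succ_self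
    rw [map_sub, sub_eq_zero] at this ⊢
    rw [this, PowerSeries.coeff_mk]
  refine ⟨L, ext_of_dvd _ _ fun k => ?_, fun A hA => ext_of_dvd _ _ fun k => ?_⟩
  · have h₁ := hF k _ _ (hL k)
    rw [← Function.iterate_succ_apply' F] at h₁
    have := dvd_sub (hL (k + 1)) h₁
    rw [sub_sub_sub_cancel_right] at this
    exact (pow_dvd_pow _ k.le_succ).trans this
  · have hAk : ∀ k, (PowerSeries.X : PowerSeries R) ^ k ∣ A - F^[k] 0 := by
      intro k
      induction k with
      | zero => simp
      | succ k ih =>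
        rw [Function.iterate_succ_apply' F, hA]
        exact hF _ _ _ ih
    have := dvd_sub (hAk k) (hL k)
    rwa [sub_sub_sub_cancel_right] at this

/-! ### Fixed point maps and the scaling action -/

section Equations

variable {𝕜 : Type} [RCLike 𝕜] {Φ : PhysicalTheory}

/-- The sum starts at n = 1, so the coefficient of order j involves powers of the argument only up
to order j - 1. -/
theorem X_pow_dvd_fixedPointMap_sub (c : ℕ → (ScaledDiagram Φ →₀ 𝕜)) (m : Scale × Scale) (k : ℕ)
    (A B : PowerSeries (DiagramAlgebra 𝕜 Φ)) (h : PowerSeries.X ^ k ∣ A - B) :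
    PowerSeries.X ^ (k + 1) ∣ fixedPointMap c m A - fixedPointMap c m B := by
  refine PowerSeries.X_pow_dvd_iff.2 fun j hj => ?_
  simp only [fixedPointMap, add_sub_add_left_eq_sub, map_sub, PowerSeries.coeff_mk]
  rw [sub_eq_zero]
  refine Finset.sum_congr rfl fun n hn => ?_
  have hn := Finset.mem_Icc.1 hn
  have hp := PowerSeries.X_pow_dvd_iff.1 (h.trans (sub_dvd_pow_sub_pow A B (n + 1))) (j - n)
    (by omega)
  rw [map_sub, sub_eq_zero] at hp
  rw [hp]

theorem existsUnique_eq_fixedPointMap (c : ℕ → (ScaledDiagram Φ →₀ 𝕜)) (m : Scale × Scale) :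
    ∃! Y, Y = fixedPointMap c m Y :=
  PowerSeries.existsUnique_fixedPoint _ (X_pow_dvd_fixedPointMap_sub c m)

theorem coeff_zero_fixedPointMap (c : ℕ → (ScaledDiagram Φ →₀ 𝕜)) (m : Scale × Scale)
    (Y : PowerSeries (DiagramAlgebra 𝕜 Φ)) :
    PowerSeries.coeff 0 (fixedPointMap c m Y) = 1 := by
  simp only [fixedPointMap, map_add, PowerSeries.coeff_mk]
  simp

/-- All powers of the argument 1 are constant, so only n = k survives: this test argument isolates
each cocycle. -/
theorem coeff_fixedPointMap_one (c : ℕ → (ScaledDiagram Φ →₀ 𝕜)) (m : Scale × Scale) {k : ℕ}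
    (hk : 1 ≤ k) :
    PowerSeries.coeff k (fixedPointMap c m 1) =
      graftingSum ((((m.1 : ℝ) : 𝕜) ^ k) • (c k).mapDomain (ScaledDiagram.rescale m.2)) 1 := by
  rw [fixedPointMap, map_add, PowerSeries.coeff_mk, PowerSeries.coeff_one, if_neg (by omega),
    zero_add, Finset.sum_eq_single_of_mem k (Finset.mem_Icc.2 ⟨hk, le_rfl⟩)]
  · simp [graftingSum_smul]
  · intro n hn hnk
    have hn := Finset.mem_Icc.1 hn
    rw [one_pow, PowerSeries.coeff_one, if_neg (by omega), map_zero, smul_zero]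

/-- The right hand sides of fixed point equations determine the rescaled cocycles. -/
theorem fixedPointMap_eq_iff (c c' : ℕ → (ScaledDiagram Φ →₀ 𝕜)) (m m' : Scale × Scale) :
    fixedPointMap c m = fixedPointMap c' m' ↔
      ∀ n, 1 ≤ n → (((m.1 : ℝ) : 𝕜) ^ n) • (c n).mapDomain (ScaledDiagram.rescale m.2) =
        (((m'.1 : ℝ) : 𝕜) ^ n) • (c' n).mapDomain (ScaledDiagram.rescale m'.2) := by
  refine ⟨fun h n hn => graftingSum_one_injective ?_, fun h => funext fun X => ?_⟩
  · simp only [← coeff_fixedPointMap_one _ _ hn, h]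
  · unfold fixedPointMap
    congr 2
    funext k
    refine Finset.sum_congr rfl fun n hn => ?_
    rw [← LinearMap.smul_apply, ← LinearMap.smul_apply, ← graftingSum_smul, ← graftingSum_smul,
      h n (Finset.mem_Icc.1 hn).1]

/-- The change of variable `g ↦ τ g` together with the rescaling of all momenta by `Λ`. -/
noncomputable def seriesRescale (τ Λ : Scale) :
    PowerSeries (DiagramAlgebra 𝕜 Φ) →+* PowerSeries (DiagramAlgebra 𝕜 Φ) :=
  (PowerSeries.rescale (algebraMap 𝕜 (DiagramAlgebra 𝕜 Φ) ((τ : ℝ) : 𝕜))).comp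
    (PowerSeries.map (momentumRescale Λ).toRingHom)

theorem coeff_seriesRescale (τ Λ : Scale) (n : ℕ) (X : PowerSeries (DiagramAlgebra 𝕜 Φ)) :
    PowerSeries.coeff n (seriesRescale τ Λ X) =
      (((τ : ℝ) : 𝕜) ^ n) • momentumRescale Λ (PowerSeries.coeff n X) := by
  rw [seriesRescale, RingHom.comp_apply, PowerSeries.coeff_rescale, PowerSeries.coeff_map,
    ← map_pow, ← Algebra.smul_def]
  rfl

/-- `seriesRescale` is multiplicative and passes through each grafting by `rename_graftingSum`,
which moves θ_Λ onto the decorations. -/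
theorem fixedPointMap_seriesRescale (c : ℕ → (ScaledDiagram Φ →₀ 𝕜)) (τ Λ : Scale)
    (X : PowerSeries (DiagramAlgebra 𝕜 Φ)) :
    fixedPointMap c (τ, Λ) (seriesRescale τ Λ X) =
      seriesRescale τ Λ (fixedPointMap c (1, 1) X) := by
  have hone : ∀ n, (c n).mapDomain (ScaledDiagram.rescale (1 : Scale)) = c n := fun n => by
    rw [show ScaledDiagram.rescale (1 : Scale) = id from funext ScaledDiagram.rescale_one,
      Finsupp.mapDomain_id]
  unfold fixedPointMap
  rw [map_add, map_one]
  congr 1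
  ext1 k
  rw [coeff_seriesRescale, PowerSeries.coeff_mk, PowerSeries.coeff_mk, map_sum, Finset.smul_sum]
  refine Finset.sum_congr rfl fun n hn => ?_
  have hn := Finset.mem_Icc.1 hn
  -- The factor of order n belongs to the cocycle, the rest to the coefficient of the power of `X`.
  have hpow : ((τ : ℝ) : 𝕜) ^ k = ((τ : ℝ) : 𝕜) ^ n * ((τ : ℝ) : 𝕜) ^ (k - n) := by
    rw [← pow_add, Nat.add_sub_cancel' hn.2]
  rw [← map_pow (seriesRescale τ Λ) X (n + 1), coeff_seriesRescale, hone, map_smul, hpow,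
    mul_smul]
  simp [momentumRescale, rename_graftingSum]

/-- The equation with its coupling multiplied by `a` and its momenta by `b`. -/
noncomputable def DysonSchwingerSpace.scale (a b : Scale) (E : DysonSchwingerSpace 𝕜 Φ) :
    DysonSchwingerSpace 𝕜 Φ :=
  ⟨fun n => (((a : ℝ) : 𝕜) ^ n) • (E.1 n).mapDomain (ScaledDiagram.rescale b), by
    obtain ⟨c, h0, ℓ, s, γ, ω, hℓ, hℓ', h⟩ := E
    -- The factor aⁿ goes into ωₙ and not into ℓ, since aℓ may exceed 1.
    refine ⟨by simp [h0], ℓ, s * b, γ, fun n => ((a : ℝ) : 𝕜) ^ n * ω n, hℓ, hℓ', fun n hn => ?_⟩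
    simp only [h n hn, Finsupp.mapDomain_single, ScaledDiagram.rescale_atScale,
      Finsupp.smul_single, smul_eq_mul]
    congr 1
    ring⟩

namespace DysonSchwingerSpace

theorem scale_scale (a b a' b' : Scale) (E : DysonSchwingerSpace 𝕜 Φ) :
    scale a b (scale a' b' E) = scale (a * a') (b * b') E := by
  refine Subtype.ext (funext fun n => ?_)
  simp only [scale, Finsupp.mapDomain_smul, smul_smul, ← Finsupp.mapDomain_comp,
    Positive.val_mul, RCLike.ofReal_mul, mul_pow]
  congr 2
  exact funext fun d => ScaledDiagram.rescale_rescale b b' d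

theorem scale_one (E : DysonSchwingerSpace 𝕜 Φ) : scale 1 1 E = E := by
  refine Subtype.ext (funext fun n => ?_)
  simp only [scale]
  rw [show ScaledDiagram.rescale (1 : Scale) = id from funext ScaledDiagram.rescale_one,
    Finsupp.mapDomain_id]
  simp

end DysonSchwingerSpace

theorem isEffective_iff_scale_eq (m m' : Scale × Scale) (E E' : DysonSchwingerSpace 𝕜 Φ) :
    IsEffective m m' E E' ↔
      DysonSchwingerSpace.scale m.1 m.2 E = DysonSchwingerSpace.scale m'.1 m'.2 E' := by
  rw [IsEffective, fixedPointMap_eq_iff, Subtype.ext_iff, funext_iff]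
  refine ⟨fun h n => ?_, fun h n _ => h n⟩
  -- The fixed point map does not see order 0; there both cocycles vanish by membership in the
  -- space.
  rcases Nat.eq_zero_or_pos n with rfl | hn
  · simp [DysonSchwingerSpace.scale, E.2.1, E'.2.1]
  · exact h n hn

theorem isEffective_iff (m m' : Scale × Scale) (E E' : DysonSchwingerSpace 𝕜 Φ) :
    IsEffective m m' E E' ↔
      E' = DysonSchwingerSpace.scale (m'.1⁻¹ * m.1) (m'.2⁻¹ * m.2) E := by
  rw [isEffective_iff_scale_eq, ← DysonSchwingerSpace.scale_scale]
  constructor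
  · intro h
    rw [h, DysonSchwingerSpace.scale_scale, inv_mul_cancel, inv_mul_cancel,
      DysonSchwingerSpace.scale_one]
  · rintro rfl
    rw [DysonSchwingerSpace.scale_scale, mul_inv_cancel, mul_inv_cancel,
      DysonSchwingerSpace.scale_one]

end Equations

/-! ### Semigroup actions from composable scale maps -/

theorem ScaleFactor.one_mul (a : Scale) : ScaleFactor.mul 1 a = a :=
  Subtype.ext (_root_.one_mul _)

theorem ScaleFactor.mul_mul (r s : ScaleFactor) (a : Scale) :
    (r * s).mul a = r.mul (s.mul a) :=
  Subtype.ext (mul_assoc _ _ _)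

/-- Composable scale maps that yield the unique effective equations form a renormalization group. -/
theorem IsRenormalizationGroup.of_comp {S M : Type} {scale : ScaleFactor → M → M}
    {Effective : M → M → S → S → Prop} {R : M → M → S → S}
    (scale_one : ∀ a, scale 1 a = a)
    (scale_mul : ∀ r s a, scale (r * s) a = scale r (scale s a))
    (effective_iff : ∀ a b E E', Effective a b E E' ↔ E' = R a b E)
    (refl : ∀ a E, R a a E = E)
    (comp : ∀ a b c E, R a b (R b c E) = R a c E)
    (comp' : ∀ a b c E, R b c (R a b E) = R a c E) :
    IsRenormalizationGroup scale Effective R where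
  effective_iff := effective_iff
  comp := comp
  comp' := comp'
  -- Here the map from a to sa is applied before that from sa to rsa, which is `comp'`; with
  -- reversed indices in `action'` it is `comp`.
  action := ⟨{
      smul r x := (R x.2 (scale r x.2) x.1, scale r x.2)
      one_smul x := Prod.ext
        (show R x.2 (scale 1 x.2) x.1 = x.1 by rw [scale_one, refl]) (scale_one x.2)
      mul_smul r s x := Prod.ext
        (show R x.2 (scale (r * s) x.2) x.1 =
            R (scale s x.2) (scale r (scale s x.2)) (R x.2 (scale s x.2) x.1) by
          rw [comp', scale_mul]) (scale_mul r s x.2) }, fun _ _ _ => rfl⟩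
  action' := ⟨{
      smul r x := (R (scale r x.2) x.2 x.1, scale r x.2)
      one_smul x := Prod.ext
        (show R (scale 1 x.2) x.2 x.1 = x.1 by rw [scale_one, refl]) (scale_one x.2)
      mul_smul r s x := Prod.ext
        (show R (scale (r * s) x.2) x.2 x.1 =
            R (scale r (scale s x.2)) (scale s x.2) (R (scale s x.2) x.2 x.1) by
          rw [comp, scale_mul]) (scale_mul r s x.2) }, fun _ _ _ => rfl⟩

end MultiScaleRG

/-! ### The three renormalization groups and the solutions -/

theorem mainTheorem5 (𝕜 : Type) [RCLike 𝕜] (Φ : MultiScaleRG.PhysicalTheory) :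
    ∃ (Rbare Rrunning : MultiScaleRG.Scale → MultiScaleRG.Scale →
        MultiScaleRG.DysonSchwingerSpace 𝕜 Φ → MultiScaleRG.DysonSchwingerSpace 𝕜 Φ)
      (Rmulti : MultiScaleRG.Scale × MultiScaleRG.Scale → MultiScaleRG.Scale × MultiScaleRG.Scale →
        MultiScaleRG.DysonSchwingerSpace 𝕜 Φ → MultiScaleRG.DysonSchwingerSpace 𝕜 Φ),
      -- rescaling of the bare coupling, at any fixed scale `Λ` of the running coupling
      (∀ Λ : MultiScaleRG.Scale,
        MultiScaleRG.IsRenormalizationGroup MultiScaleRG.ScaleFactor.mul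
          (fun τ τ' => MultiScaleRG.IsEffective (τ, Λ) (τ', Λ)) Rbare) ∧
      -- rescaling of the running coupling, at any fixed scale `τ` of the bare coupling
      (∀ τ : MultiScaleRG.Scale,
        MultiScaleRG.IsRenormalizationGroup MultiScaleRG.ScaleFactor.mul
          (fun Λ Λ' => MultiScaleRG.IsEffective (τ, Λ) (τ, Λ')) Rrunning) ∧
      -- joint rescaling
      MultiScaleRG.IsRenormalizationGroup MultiScaleRG.ScaleFactor.mulPair
        MultiScaleRG.IsEffective Rmulti ∧
      (∀ τ τ' Λ, Rmulti (τ, Λ) (τ', Λ) = Rbare τ τ') ∧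
      (∀ τ Λ Λ', Rmulti (τ, Λ) (τ, Λ') = Rrunning Λ Λ') ∧
      -- each equation at the scales `(τ, Λ)` has the unique solution `∑ₙ (τ g)ⁿ Xₙ(Λ)`
      (∀ D : MultiScaleRG.DysonSchwingerSpace 𝕜 Φ,
        ∃ X : ℕ → MultiScaleRG.DiagramAlgebra 𝕜 Φ, X 0 = 1 ∧
          ∀ (τ Λ : MultiScaleRG.Scale) (Y : PowerSeries (MultiScaleRG.DiagramAlgebra 𝕜 Φ)),
            Y = MultiScaleRG.fixedPointMap D.1 (τ, Λ) Y ↔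
              Y = PowerSeries.mk fun n =>
                (((τ : ℝ) : 𝕜) ^ n) • MultiScaleRG.momentumRescale Λ (X n)) := by
  -- Telescoping of the scale quotients in the two orders of composition.
  have hc : ∀ a b c : Scale, b⁻¹ * a * (c⁻¹ * b) = c⁻¹ * a := fun a b c => by
    rw [mul_comm, mul_assoc, mul_inv_cancel_left]
  have hc' : ∀ a b c : Scale, c⁻¹ * b * (b⁻¹ * a) = c⁻¹ * a := fun a b c => by
    rw [mul_assoc, mul_inv_cancel_left]
  refine ⟨fun τ τ' => DysonSchwingerSpace.scale (τ'⁻¹ * τ) 1,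
    fun Λ Λ' => DysonSchwingerSpace.scale 1 (Λ'⁻¹ * Λ),
    fun m m' => DysonSchwingerSpace.scale (m'.1⁻¹ * m.1) (m'.2⁻¹ * m.2),
    fun Λ => ?_, fun τ => ?_, ?_, fun τ τ' Λ => ?_, fun τ Λ Λ' => ?_, fun E => ?_⟩
  · refine .of_comp ScaleFactor.one_mul ScaleFactor.mul_mul (fun a b E E' => ?_) (fun a E => ?_)
      (fun a b c E => ?_) fun a b c E => ?_
    · simp only [isEffective_iff, inv_mul_cancel]
    · simp only [inv_mul_cancel, DysonSchwingerSpace.scale_one]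
    · simp only [DysonSchwingerSpace.scale_scale, hc, mul_one]
    · simp only [DysonSchwingerSpace.scale_scale, hc', mul_one]
  · refine .of_comp ScaleFactor.one_mul ScaleFactor.mul_mul (fun a b E E' => ?_) (fun a E => ?_)
      (fun a b c E => ?_) fun a b c E => ?_
    · simp only [isEffective_iff, inv_mul_cancel]
    · simp only [inv_mul_cancel, DysonSchwingerSpace.scale_one]
    · simp only [DysonSchwingerSpace.scale_scale, hc, mul_one]
    · simp only [DysonSchwingerSpace.scale_scale, hc', mul_one]
  · refine .of_comp
      (fun a => Prod.ext (ScaleFactor.one_mul a.1) (ScaleFactor.one_mul a.2))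
      (fun r s a => Prod.ext (ScaleFactor.mul_mul r s a.1) (ScaleFactor.mul_mul r s a.2))
      isEffective_iff (fun a E => ?_) (fun a b c E => ?_) fun a b c E => ?_
    · simp only [inv_mul_cancel, DysonSchwingerSpace.scale_one]
    · simp only [DysonSchwingerSpace.scale_scale, hc]
    · simp only [DysonSchwingerSpace.scale_scale, hc']
  · simp only [inv_mul_cancel]
  · simp only [inv_mul_cancel]
  -- The Xₙ are the coefficients of the solution at the scales (1, 1).
  · obtain ⟨L, hL, -⟩ := existsUnique_eq_fixedPointMap E.1 (1, 1)
    refine ⟨fun n => PowerSeries.coeff n L, ?_, fun τ Λ Y => ?_⟩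
    · beta_reduce
      rw [hL, coeff_zero_fixedPointMap]
    · have hmk : (PowerSeries.mk fun n =>
          (((τ : ℝ) : 𝕜) ^ n) • momentumRescale Λ (PowerSeries.coeff n L)) =
            seriesRescale τ Λ L := by
        ext1 n
        rw [coeff_seriesRescale, PowerSeries.coeff_mk]
      have hfix : seriesRescale τ Λ L = fixedPointMap E.1 (τ, Λ) (seriesRescale τ Λ L) := by
        rw [fixedPointMap_seriesRescale, ← hL]
      rw [hmk]
      refine ⟨fun hY => (existsUnique_eq_fixedPointMap E.1 (τ, Λ)).unique hY hfix, ?_⟩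
      rintro rfl
      exact hfix
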